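/- Let $\mathbb D=\{z\in\mathbb C:|z|<1\}$ and let $\alpha\in(1,2)$. Let $CO(\alpha)$ be the class of functions $h$ that are analytic and univalent in $\mathbb D$, normalized by $h(0)=0=h'(0)-1$, with $h(1)=\infty$ (that is, $|h(z)|\to\infty$ as $z\to1$ in $\mathbb D$), such that $\mathbb C\setminus h(\mathbb D)$ is convex and the opening angle of $h(\mathbb D)$ at $\infty$ is at most $\pi\alpha$. Here the opening angle at $\infty$ of $\Omega\subset\mathbb C$ is the Lebesgue measure of the set of $\theta\in(-\pi,\pi]$ such that $Re^{i\theta}\in\Omega$ for all sufficiently large $R$. Let $f=h+\overline g$ in $\mathbb D$ belong to $CO_H(\alpha)$, that is, $h\in CO(\alpha)$, $g$ is analytic in $\mathbb D$, and $g'=\omega h'$ in $\mathbb D$ with $|\omega(z)|<1$ for $z\in\mathbb D$. If $$|\omega(z)|<\sin\Big(\frac{2-\alpha}{2}\,\pi\Big)\qquad\text{for all } z\in\mathbb D,$$ then $f$ is close-to-convex in $\mathbb D$; that is, $f$ is univalent (injective) in $\mathbb D$, and $\mathbb C\setminus f(\mathbb D)$ is a union of closed half-lines whose (relative) interiors are pairwise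 disjoint. -/

import Mathlib

open Set Filter Topology MeasureTheory

/-- The open unit disk `𝔻 = {z ∈ ℂ : |z| < 1}`. -/
def unitDisk : Set ℂ := Metric.ball (0 : ℂ) 1

/-- The opening angle at `∞` of a plane set `Ω`: the angular (Lebesgue) measure of the set of
directions `θ` for which the ray `{R e^{iθ} : R > 0}` eventually stays in `Ω`. When the complement
of `Ω` is closed and convex, this is `2π` minus the angle of the recession cone of the complement,
and it does not depend on the choice of the origin. -/
noncomputable def openingAngleAtInfinity (Ω : Set ℂ) : ENNReal :=
  volume {θ : ℝ | θ ∈ Ioc (-Real.pi) Real.pi ∧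
    ∀ᶠ R : ℝ in atTop, (R : ℂ) * Complex.exp ((θ : ℂ) * Complex.I) ∈ Ω}

/-- The class `CO(α)` of concave univalent functions: normalized functions `h`, analytic and
univalent in the unit disk, whose image has a convex complement in `ℂ`, with `h(1) = ∞`, and such
that the opening angle of `h(𝔻)` at `∞` is at most `πα`. -/
structure MemCO (α : ℝ) (h : ℂ → ℂ) : Prop where
  analytic : DifferentiableOn ℂ h unitDisk
  univalent : InjOn h unitDisk
  map_zero : h 0 = 0
  deriv_zero : deriv h 0 = 1
  convex_compl : Convex ℝ (h '' unitDisk)ᶜ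
  map_one : Tendsto h (𝓝[unitDisk] 1) (Bornology.cobounded ℂ)
  openingAngle_le : openingAngleAtInfinity (h '' unitDisk) ≤ ENNReal.ofReal (Real.pi * α)

/-- `f = h + conj g` on the unit disk belongs to the class `CO_H(α)`, with (second complex)
dilatation `ω`: here `h ∈ CO(α)`, `g` is analytic, `g' = ω h'` and `|ω| < 1` in the unit disk.
(Since `h' ≠ 0`, the dilatation `ω = g' / h'` is then automatically analytic there.) -/
structure MemCOH (α : ℝ) (f h g ω : ℂ → ℂ) : Prop where
  concave : MemCO α h
  analytic : DifferentiableOn ℂ g unitDisk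
  decomposition : ∀ z ∈ unitDisk, f z = h z + (starRingEnd ℂ) (g z)
  dilatation : ∀ z ∈ unitDisk, deriv g z = ω z * deriv h z
  dilatation_lt_one : ∀ z ∈ unitDisk, ‖ω z‖ < 1

/-- The closed half-line with origin `a` in the direction `u`. -/
def closedHalfLine (a u : ℂ) : Set ℂ := {w | ∃ t : ℝ, 0 ≤ t ∧ w = a + (t : ℂ) * u}

/-- The (relative) interior of the half-line with origin `a` in the direction `u`. -/
def openHalfLine (a u : ℂ) : Set ℂ := {w | ∃ t : ℝ, 0 < t ∧ w = a + (t : ℂ) * u}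

/-- `Ω` is close-to-convex: its complement in `ℂ` is the union of closed half-lines with
pairwise disjoint interiors. The set `L` consists of the pairs (origin, unit direction). -/
def IsCloseToConvexDomain (Ω : Set ℂ) : Prop :=
  ∃ L : Set (ℂ × ℂ), (∀ p ∈ L, ‖p.2‖ = 1) ∧
    L.PairwiseDisjoint (fun p => openHalfLine p.1 p.2) ∧
    Ωᶜ = ⋃ p ∈ L, closedHalfLine p.1 p.2

/-- A function on the unit disk is close-to-convex if it is univalent there and its range is a
close-to-convex domain. -/
def IsCloseToConvex (f : ℂ → ℂ) : Prop :=
  InjOn f unitDisk ∧ IsCloseToConvexDomain (f '' unitDisk)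

/-! Write `Ω = h(𝔻)`, `K = Ωᶜ`, `β = (2 - α)π / 2` and `ψ = g ∘ h⁻¹`. Then `f = Φ ∘ h` with `Φ w = w
+ conj (ψ w)`, and `ψ' = ω ∘ h⁻¹` is bounded by `sin β` on `Ω`. It remains to study the shear `Φ` on
`Ω`.

Directions whose rays do not eventually stay in `Ω` are recession directions of the closed convex
set `K`. They fill an angle of at least `2π - πα = 2β`, so the recession cone contains a sector `S`
of half-angle `β` about some `u` (`exists_sector_subset_recessionDirections`), and hence `Ω - S ⊆
Ω`.

Injectivity (`injOn_add_conj`): two points of `Ω` either differ by an element of `±S`, and are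
joined by a segment in `Ω`, or can be moved back along the two edges of `S` to a common point of
`Ω`. The length of that path times `sin β` is at most their distance, so `ψ` strictly decreases
distances and `Φ` is injective.

Range (`sub_mem_image_add_conj`): as `Φ` is a perturbation of the identity with Lipschitz constant
`sin β` on segments in `Ω`, moving the image point along `-u` moves its preimage inside `-S`, so it
never leaves `Ω`. Thus `Φ(Ω)` is open and invariant in the direction `-u`, and
`isCloseToConvexDomain_of_sub_mem` applies. -/

/-! ### Inverses of univalent functions. -/

section Univalent

variable {U : Set ℂ} {h : ℂ → ℂ}

lemma isOpen_image_of_injOn (hU : IsOpen U) (hc : IsPreconnected U)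
    (hd : DifferentiableOn ℂ h U) (hi : InjOn h U) {s : Set ℂ} (hs : s ⊆ U) (ho : IsOpen s) :
    IsOpen (h '' s) := by
  rcases (hd.analyticOnNhd hU).is_constant_or_isOpen hc with ⟨w, hw⟩ | H
  · rcases s.eq_empty_or_nonempty with rfl | ⟨z, hz⟩
    · simp
    · exfalso
      have hsub : s ⊆ {z} := fun y hy => hi (hs hy) (hs hz) ((hw y (hs hy)).trans (hw z (hs hz)).symm)
      have : s = {z} := hsub.antisymm (singleton_subset_iff.2 hz)
      exact not_isOpen_singleton z (this ▸ ho)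
  · exact H s hs ho

lemma continuousOn_invFunOn (hU : IsOpen U) (hc : IsPreconnected U)
    (hd : DifferentiableOn ℂ h U) (hi : InjOn h U) :
    ContinuousOn (Function.invFunOn h U) (h '' U) := by
  rintro _ ⟨z, hz, rfl⟩
  refine ContinuousAt.continuousWithinAt ?_
  have hφ : Function.invFunOn h U (h z) = z := hi.leftInvOn_invFunOn hz
  intro N hN
  rw [hφ] at hN
  obtain ⟨V, hVN, hV, hzV⟩ := mem_nhds_iff.1 hN
  refine mem_map.2 (mem_of_superset ((isOpen_image_of_injOn hU hc hd hi
    (s := V ∩ U) inter_subset_right (hV.inter hU)).mem_nhds ⟨z, ⟨hzV, hz⟩, rfl⟩) ?_)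
  rintro _ ⟨y, ⟨hyV, hyU⟩, rfl⟩
  rw [mem_preimage, hi.leftInvOn_invFunOn hyU]
  exact hVN hyV

lemma hasDerivAt_invFunOn (hU : IsOpen U) (hc : IsPreconnected U)
    (hd : DifferentiableOn ℂ h U) (hi : InjOn h U) {z : ℂ} (hz : z ∈ U) (h0 : deriv h z ≠ 0) :
    HasDerivAt (Function.invFunOn h U) (deriv h z)⁻¹ (h z) := by
  have hφ : Function.invFunOn h U (h z) = z := hi.leftInvOn_invFunOn hz
  have hO := isOpen_image_of_injOn hU hc hd hi subset_rfl hU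
  have hn : h '' U ∈ 𝓝 (h z) := hO.mem_nhds ⟨z, hz, rfl⟩
  refine HasDerivAt.of_local_left_inverse (f := h)
    ((continuousOn_invFunOn hU hc hd hi).continuousAt hn) ?_ h0 ?_
  · rw [hφ]; exact (hd.differentiableAt (hU.mem_nhds hz)).hasDerivAt
  · filter_upwards [hn] with y hy
    exact Function.invFunOn_eq hy

/-- Zeros of `h'` are isolated, since otherwise `h` would be locally constant. Away from them the
inverse is differentiable, and continuity makes the exceptional point a removable singularity. -/
lemma differentiableOn_invFunOn (hU : IsOpen U) (hc : IsPreconnected U)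
    (hd : DifferentiableOn ℂ h U) (hi : InjOn h U) :
    DifferentiableOn ℂ (Function.invFunOn h U) (h '' U) := by
  rintro _ ⟨z, hz, rfl⟩
  have hO := isOpen_image_of_injOn hU hc hd hi subset_rfl hU
  have hcont := (continuousOn_invFunOn hU hc hd hi).continuousAt (hO.mem_nhds ⟨z, hz, rfl⟩)
  have hφ : Function.invFunOn h U (h z) = z := hi.leftInvOn_invFunOn hz
  have han : AnalyticAt ℂ (deriv h) z := (hd.analyticOnNhd hU z hz).deriv
  rcases han.eventually_eq_zero_or_eventually_ne_zero with h0 | h0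
  · exfalso
    obtain ⟨ε, hε, hball⟩ := Metric.eventually_nhds_iff_ball.1 (h0.and (hU.mem_nhds hz))
    have hconst : ∀ y ∈ Metric.ball z ε, h y = h z := by
      intro y hy
      have := (convex_ball z ε).norm_image_sub_le_of_norm_deriv_le (f := h) (C := 0)
        (fun x hx => hd.differentiableAt (hU.mem_nhds (hball x hx).2))
        (fun x hx => by rw [(hball x hx).1, norm_zero]) (Metric.mem_ball_self hε) hy
      simpa [sub_eq_zero] using this
    have hy : z + (ε / 2 : ℝ) ∈ Metric.ball z ε := by
      simp [abs_of_pos hε, hε]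
    have := hi (hball _ hy).2 hz (hconst _ hy)
    simp [hε.ne'] at this
  · have hev : ∀ᶠ y in 𝓝 z, y ∈ U ∧ (y ≠ z → deriv h y ≠ 0) :=
      (show ∀ᶠ y in 𝓝 z, y ∈ U from hU.mem_nhds hz).and (eventually_nhdsWithin_iff.1 h0)
    obtain ⟨V, hV, hVo, hzV⟩ := eventually_nhds_iff.1 hev
    have hVU : V ⊆ U := fun y hy => (hV y hy).1
    have hn : h '' V ∈ 𝓝 (h z) :=
      (isOpen_image_of_injOn hU hc hd hi hVU hVo).mem_nhds ⟨z, hzV, rfl⟩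
    have := (Complex.differentiableOn_compl_singleton_and_continuousAt_iff hn).1
      ⟨?_, hcont⟩
    · exact (this.differentiableAt hn).differentiableWithinAt
    · rintro _ ⟨⟨y, hy, rfl⟩, hne⟩
      refine (hasDerivAt_invFunOn hU hc hd hi (hVU hy)
        ((hV y hy).2 ?_)).differentiableAt.differentiableWithinAt
      rintro rfl
      exact hne rfl

/-- The derivative of an injective holomorphic function does not vanish. -/
lemma deriv_ne_zero_of_injOn (hU : IsOpen U) (hc : IsPreconnected U)
    (hd : DifferentiableOn ℂ h U) (hi : InjOn h U) {z : ℂ} (hz : z ∈ U) : deriv h z ≠ 0 := by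
  have hO := isOpen_image_of_injOn hU hc hd hi subset_rfl hU
  have h1 : HasDerivAt (Function.invFunOn h U) _ (h z) :=
    ((differentiableOn_invFunOn hU hc hd hi).differentiableAt
      (hO.mem_nhds ⟨z, hz, rfl⟩)).hasDerivAt
  have h2 := h1.comp z (hd.differentiableAt (hU.mem_nhds hz)).hasDerivAt
  have h3 : HasDerivAt (Function.invFunOn h U ∘ h) 1 z := by
    refine (hasDerivAt_id z).congr_of_eventuallyEq ?_
    filter_upwards [hU.mem_nhds hz] with y hy
    exact hi.leftInvOn_invFunOn hy
  have := h2.unique h3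
  intro h0
  simp [h0] at this

end Univalent

/-! ### Geometry of sectors. -/

section Sector

/-- The closed sector of half-angle `β` (for `0 < β < π / 2`) with axis in the direction `u`. -/
def sector (β : ℝ) (u : ℂ) : Set ℂ :=
  {c | |(c / u).im| * Real.cos β ≤ (c / u).re * Real.sin β}

variable {β : ℝ} {u : ℂ}

lemma convex_sector (hc : 0 ≤ Real.cos β) : Convex ℝ (sector β u) := by
  intro c hc1 d hd1 s t hs ht _
  simp only [sector, mem_ofPred_eq] at *
  have e : (s • c + t • d) / u = s • (c / u) + t • (d / u) := by
    simp only [Complex.real_smul]; ring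
  rw [e]
  simp only [Complex.add_im, Complex.add_re, Complex.real_smul, Complex.re_ofReal_mul,
    Complex.im_ofReal_mul]
  have h1 : |s * (c / u).im + t * (d / u).im| ≤ s * |(c / u).im| + t * |(d / u).im| := by
    refine (abs_add_le _ _).trans ?_
    rw [abs_mul, abs_mul, abs_of_nonneg hs, abs_of_nonneg ht]
  have h2 := mul_le_mul_of_nonneg_right h1 hc
  have h3 := mul_le_mul_of_nonneg_left hc1 hs
  have h4 := mul_le_mul_of_nonneg_left hd1 ht
  linarith

lemma isClosed_sector : IsClosed (sector β u) := by
  refine isClosed_le ?_ ?_ <;> fun_prop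

lemma zero_mem_sector : (0 : ℂ) ∈ sector β u := by simp [sector]

lemma smul_mem_sector {c : ℂ} (hc : c ∈ sector β u) {t : ℝ} (ht : 0 ≤ t) :
    (t : ℂ) * c ∈ sector β u := by
  simp only [sector, mem_ofPred_eq, mul_div_assoc, Complex.re_ofReal_mul,
    Complex.im_ofReal_mul, abs_mul, abs_of_nonneg ht] at *
  have := mul_le_mul_of_nonneg_left hc ht
  linarith

/-- Coordinates with respect to the two extreme directions of a sector. -/
lemma eq_extreme_add_extreme (hs : Real.sin β ≠ 0) (hc : Real.cos β ≠ 0) (hu : u ≠ 0) (c : ℂ) :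
    c = (((c / u).re / Real.cos β + (c / u).im / Real.sin β) / 2 : ℝ) *
        (u * Complex.exp (β * Complex.I)) +
      (((c / u).re / Real.cos β - (c / u).im / Real.sin β) / 2 : ℝ) *
        (u * Complex.exp (-β * Complex.I)) := by
  have hsc : (Real.sin β : ℂ) ≠ 0 := by exact_mod_cast hs
  have hcc : (Real.cos β : ℂ) ≠ 0 := by exact_mod_cast hc
  have hre : c = u * ((c / u).re + (c / u).im * Complex.I) := by
    rw [Complex.re_add_im]; field_simp
  have e1 : Complex.exp (β * Complex.I) = Real.cos β + Real.sin β * Complex.I := by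
    rw [Complex.exp_mul_I]; push_cast; rfl
  have e2 : Complex.exp (-β * Complex.I) = Real.cos β - Real.sin β * Complex.I := by
    rw [Complex.exp_mul_I]; push_cast; rw [Complex.cos_neg, Complex.sin_neg]; ring
  rw [e1, e2]
  conv_lhs => rw [hre]
  generalize (c / u).re = x
  generalize (c / u).im = y
  push_cast at hsc hcc ⊢
  field_simp
  ring

lemma exp_mem_sector {b : ℝ} (hb : |Real.sin b| * Real.cos β ≤ Real.cos b * Real.sin β)
    (hu : u ≠ 0) : u * Complex.exp (b * Complex.I) ∈ sector β u := by
  simp only [sector, mem_ofPred_eq, mul_div_cancel_left₀ _ hu, Complex.exp_ofReal_mul_I_re,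
    Complex.exp_ofReal_mul_I_im]
  exact hb

/-- The law of sines in the triangle `0`, `ρ u`, `e` bounds the sine of the angle at `0` by `‖e - ρ
u‖ / ‖e‖ ≤ sin β`; this angle is acute because `(e / u).re > 0`. -/
lemma mem_sector_of_norm_sub_le (hu : ‖u‖ = 1) (hs : 0 < Real.sin β) (hc : 0 < Real.cos β)
    {e : ℂ} {ρ : ℝ} (hρ : 0 < ρ) (h : ‖e - ρ * u‖ ≤ Real.sin β * ‖e‖) : e ∈ sector β u := by
  have hu0 : u ≠ 0 := norm_ne_zero_iff.1 (by rw [hu]; exact one_ne_zero)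
  have h1 : ‖e / u - ρ‖ ≤ Real.sin β * ‖e / u‖ := by
    have e1 : e / u - ρ = (e - ρ * u) / u := by field_simp
    rw [e1, norm_div, norm_div, hu, div_one, div_one]; exact h
  simp only [sector, mem_ofPred_eq]
  generalize e / u = d at h1
  have h2 : ‖d - ρ‖ ^ 2 ≤ Real.sin β ^ 2 * ‖d‖ ^ 2 := by
    rw [← mul_pow]; exact pow_le_pow_left₀ (norm_nonneg _) h1 2
  rw [← Complex.normSq_eq_norm_sq, ← Complex.normSq_eq_norm_sq, Complex.normSq_apply,
    Complex.normSq_apply] at h2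
  simp only [Complex.sub_re, Complex.sub_im, Complex.ofReal_re, Complex.ofReal_im, sub_zero] at h2
  have hsc := Real.sin_sq_add_cos_sq β
  set S := Real.sin β
  set C := Real.cos β
  have hC : C ^ 2 = 1 - S ^ 2 := by linarith
  have hS1 : 0 ≤ 1 - S ^ 2 := by rw [← hC]; positivity
  have hx : 0 < d.re := by
    by_contra hx
    push Not at hx
    have a1 : 0 ≤ (1 - S ^ 2) * (d.re * d.re + d.im * d.im) :=
      mul_nonneg hS1 (by nlinarith)
    nlinarith [mul_nonneg hρ.le (neg_nonneg.2 hx), mul_pos hρ hρ]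
  have hsq : (|d.im| * C) ^ 2 ≤ (d.re * S) ^ 2 := by
    rw [mul_pow, sq_abs, hC]
    nlinarith [sq_nonneg (d.re - ρ)]
  exact (pow_le_pow_iff_left₀ (by positivity) (by positivity) two_ne_zero).1 hsq

end Sector

/-! ### Harmonic shears of domains invariant under a sector. -/

section Shear

variable {Ω : Set ℂ} {ψ : ℂ → ℂ} {k : ℝ}

/-- The inequality stays strict because `‖ψ'‖` attains its maximum on the compact segment. -/
lemma norm_sub_lt_of_segment_subset (hΩ : IsOpen Ω) (hψ : DifferentiableOn ℂ ψ Ω)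
    (hk : ∀ w ∈ Ω, ‖deriv ψ w‖ < k) {x y : ℂ} (hxy : segment ℝ x y ⊆ Ω) (hne : x ≠ y) :
    ‖ψ x - ψ y‖ < k * ‖x - y‖ := by
  have hcpt : IsCompact (segment ℝ x y) := by
    rw [segment_eq_image_lineMap]
    exact isCompact_Icc.image AffineMap.lineMap_continuous
  have hcont : ContinuousOn (fun w => ‖deriv ψ w‖) (segment ℝ x y) :=
    ((hψ.deriv hΩ).continuousOn.mono hxy).norm
  obtain ⟨m, hm, hmax⟩ := hcpt.exists_isMaxOn ⟨x, left_mem_segment ℝ x y⟩ hcont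
  have h1 := (convex_segment x y).norm_image_sub_le_of_norm_deriv_le (f := ψ)
    (fun w hw => hψ.differentiableAt (hΩ.mem_nhds (hxy hw))) (fun w hw => hmax hw)
    (right_mem_segment ℝ x y) (left_mem_segment ℝ x y)
  exact h1.trans_lt (mul_lt_mul_of_pos_right (hk m (hxy hm)) (norm_pos_iff.2 (sub_ne_zero.2 hne)))

lemma norm_sub_le_of_segment_subset (hΩ : IsOpen Ω) (hψ : DifferentiableOn ℂ ψ Ω)
    (hk : ∀ w ∈ Ω, ‖deriv ψ w‖ < k) {x y : ℂ} (hxy : segment ℝ x y ⊆ Ω) :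
    ‖ψ x - ψ y‖ ≤ k * ‖x - y‖ := by
  rcases eq_or_ne x y with rfl | hne
  · simp
  · exact (norm_sub_lt_of_segment_subset hΩ hψ hk hxy hne).le

variable {β : ℝ} {u : ℂ}

lemma segment_subset_of_sub_mem_sector (hc : 0 < Real.cos β)
    (hcone : ∀ w ∈ Ω, ∀ c ∈ sector β u, w - c ∈ Ω) {w x y : ℂ} (hw : w ∈ Ω)
    (hx : w - x ∈ sector β u) (hy : w - y ∈ sector β u) : segment ℝ x y ⊆ Ω := by
  rintro _ ⟨s, t, hs, ht, hst, rfl⟩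
  have := hcone w hw _ (convex_sector hc.le hx hy hs ht hst)
  have e : w - (s • (w - x) + t • (w - y)) = s • x + t • y := by
    have : (t : ℂ) = 1 - s := by rw [eq_sub_iff_add_eq', ← Complex.ofReal_add, hst, Complex.ofReal_one]
    simp only [Complex.real_smul, this]; ring
  rwa [e] at this

/-- After division by `u`, the imaginary part of the difference is `(s + t) sin β`. This is the
source of the constant `sin β` in the theorem. -/
lemma sin_mul_add_le_norm_sub (hs : 0 ≤ Real.sin β) (hu : ‖u‖ = 1) {s t : ℝ} (hs0 : 0 ≤ s)
    (ht0 : 0 ≤ t) : Real.sin β * (s + t) ≤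
      ‖s * (u * Complex.exp (β * Complex.I)) - t * (u * Complex.exp (-β * Complex.I))‖ := by
  have e : (s : ℂ) * (u * Complex.exp (β * Complex.I)) - t * (u * Complex.exp (-β * Complex.I)) =
      u * (((s - t) * Real.cos β : ℝ) + ((s + t) * Real.sin β : ℝ) * Complex.I) := by
    have e2 : (-β : ℂ) = ((-β : ℝ) : ℂ) := by push_cast; rfl
    rw [e2, Complex.exp_mul_I, Complex.exp_mul_I]
    push_cast
    rw [Complex.cos_neg, Complex.sin_neg]; ring
  rw [e, norm_mul, hu, one_mul]
  refine le_trans (le_of_eq ?_) (Complex.abs_im_le_norm _)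
  simp only [Complex.add_im, Complex.ofReal_im, Complex.im_ofReal_mul, Complex.I_im, mul_one,
    zero_add]
  rw [abs_of_nonneg (by positivity)]; ring

/-- If `Ω` is invariant under translations by `-sector β u`, then a harmonic shear of `Ω` whose
co-analytic part has derivative less than `sin β` is injective. -/
lemma injOn_add_conj (hΩ : IsOpen Ω) (hψ : DifferentiableOn ℂ ψ Ω) (hβ : β ∈ Ioo 0 (Real.pi / 2))
    (hu : ‖u‖ = 1) (hk : ∀ w ∈ Ω, ‖deriv ψ w‖ < Real.sin β)
    (hcone : ∀ w ∈ Ω, ∀ c ∈ sector β u, w - c ∈ Ω) :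
    InjOn (fun w => w + (starRingEnd ℂ) (ψ w)) Ω := by
  have hs : 0 < Real.sin β := Real.sin_pos_of_pos_of_lt_pi hβ.1 (by linarith [hβ.2, Real.pi_pos])
  have hc : 0 < Real.cos β := Real.cos_pos_of_mem_Ioo ⟨by linarith [hβ.1, Real.pi_pos], hβ.2⟩
  have hs1 : Real.sin β ≤ 1 := Real.sin_le_one β
  have hu0 : u ≠ 0 := norm_ne_zero_iff.1 (by rw [hu]; exact one_ne_zero)
  have ha : u * Complex.exp (β * Complex.I) ∈ sector β u :=
    exp_mem_sector (by rw [abs_of_pos hs, mul_comm]) hu0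
  have hb : u * Complex.exp (-β * Complex.I) ∈ sector β u := by
    have := exp_mem_sector (β := β) (b := -β)
      (by rw [Real.sin_neg, abs_neg, abs_of_pos hs, Real.cos_neg, mul_comm]) hu0
    simpa using this
  have hna : ‖u * Complex.exp (β * Complex.I)‖ = 1 := by
    rw [norm_mul, hu, Complex.norm_exp_ofReal_mul_I, one_mul]
  have hnb : ‖u * Complex.exp (-β * Complex.I)‖ = 1 := by
    have := Complex.norm_exp_ofReal_mul_I (-β)
    push_cast at this
    rw [norm_mul, hu, this, one_mul]
  have hab : ∀ {s t : ℝ}, 0 ≤ s → 0 ≤ t → _ := fun {s t} => sin_mul_add_le_norm_sub hs.le hu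
    (s := s) (t := t)
  have key : ∀ c : ℂ, ∃ s t : ℝ, c = s * (u * Complex.exp (β * Complex.I)) +
      t * (u * Complex.exp (-β * Complex.I)) :=
    fun c => ⟨_, _, eq_extreme_add_extreme hs.ne' hc.ne' hu0 c⟩
  generalize u * Complex.exp (β * Complex.I) = a at *
  generalize u * Complex.exp (-β * Complex.I) = b at *
  -- strict contraction of `ψ` with respect to the Euclidean distance
  have same : ∀ x ∈ Ω, ∀ c ∈ sector β u, c ≠ 0 → ‖ψ x - ψ (x - c)‖ < Real.sin β * ‖c‖ := by
    intro x hx c hcs hc0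
    have := norm_sub_lt_of_segment_subset hΩ hψ hk (x := x) (y := x - c)
      (segment_subset_of_sub_mem_sector hc hcone hx (by simpa using zero_mem_sector)
        (by simpa using hcs)) (fun h => hc0 (by linear_combination h))
    simpa using this
  have same' : ∀ x ∈ Ω, ∀ c ∈ sector β u, ‖ψ x - ψ (x - c)‖ ≤ Real.sin β * ‖c‖ := by
    intro x hx c hcs
    rcases eq_or_ne c 0 with rfl | h0
    · simp
    · exact (same x hx c hcs h0).le
  -- Travel from `x` to `y` through the common point `x - s a = y - t b`, a path of length `s + t`;
  -- strictness comes from whichever leg is nondegenerate.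
  have opp : ∀ x ∈ Ω, ∀ y ∈ Ω, ∀ s t : ℝ, 0 ≤ s → 0 ≤ t → x - s * a = y - t * b → x ≠ y →
      ‖ψ x - ψ y‖ < ‖x - y‖ := by
    intro x hx y hy s t hs0 ht0 hxy hne
    have hd : x - y = s * a - t * b := by linear_combination hxy
    have hxs := smul_mem_sector ha hs0
    have hyt := smul_mem_sector hb ht0
    have n1 : ‖(s : ℂ) * a‖ = s := by rw [norm_mul, hna, mul_one, Complex.norm_of_nonneg hs0]
    have n2 : ‖(t : ℂ) * b‖ = t := by rw [norm_mul, hnb, mul_one, Complex.norm_of_nonneg ht0]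
    have tri : ‖ψ x - ψ y‖ ≤ ‖ψ x - ψ (x - s * a)‖ + ‖ψ y - ψ (y - t * b)‖ := by
      rw [← hxy, norm_sub_rev (ψ y)]
      exact norm_sub_le_norm_sub_add_norm_sub _ _ _
    have b1 := same' x hx _ hxs
    have b2 := same' y hy _ hyt
    have b3 := hab hs0 ht0
    rw [n1] at b1
    rw [n2] at b2
    rw [hd]
    rcases eq_or_ne ((s : ℂ) * a) 0 with h1 | h1
    · have h2 : (t : ℂ) * b ≠ 0 := by
        intro h2; rw [h1, h2, sub_zero, sub_zero] at hxy; exact hne hxy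
      have := same y hy _ hyt h2
      rw [n2] at this
      linarith
    · have := same x hx _ hxs h1
      rw [n1] at this
      linarith
  have dir : ∀ x ∈ Ω, ∀ y, x - y ∈ sector β u → x ≠ y → ‖ψ x - ψ y‖ < ‖x - y‖ := by
    intro x hx y hy hne
    have := same x hx _ hy (sub_ne_zero.2 hne)
    rw [sub_sub_cancel] at this
    exact this.trans_le (mul_le_of_le_one_left (norm_nonneg _) hs1)
  have hsec : ∀ s t : ℝ, 0 ≤ s → 0 ≤ t → (s : ℂ) * a + t * b ∈ sector β u := by
    intro s t hs0 ht0
    have := smul_mem_sector (convex_sector hc.le (smul_mem_sector ha hs0) (smul_mem_sector hb ht0)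
      (a := 1 / 2) (b := 1 / 2) (by norm_num) (by norm_num) (by norm_num)) (t := 2) (by norm_num)
    convert this using 1
    simp only [Complex.real_smul]; push_cast; ring
  have main : ∀ x ∈ Ω, ∀ y ∈ Ω, x ≠ y → ‖ψ x - ψ y‖ < ‖x - y‖ := by
    intro x hx y hy hne
    obtain ⟨s, t, hst⟩ := key (x - y)
    rcases le_total 0 s with hs0 | hs0 <;> rcases le_total 0 t with ht0 | ht0
    · exact dir x hx y (hst ▸ hsec s t hs0 ht0) hne
    · exact opp x hx y hy s (-t) hs0 (neg_nonneg.2 ht0)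
        (by push_cast; linear_combination hst) hne
    · rw [norm_sub_rev, norm_sub_rev x]
      exact opp y hy x hx (-s) t (neg_nonneg.2 hs0) ht0
        (by push_cast; linear_combination -hst) hne.symm
    · rw [norm_sub_rev, norm_sub_rev x]
      refine dir y hy x ?_ hne.symm
      have := hsec (-s) (-t) (neg_nonneg.2 hs0) (neg_nonneg.2 ht0)
      convert this using 1
      push_cast; linear_combination -hst
  intro x hx y hy hxy
  by_contra hne
  refine (main x hx y hy hne).ne ?_
  have : x - y = -(starRingEnd ℂ) (ψ x - ψ y) := by
    simp only at hxy
    rw [map_sub]; linear_combination hxy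
  rw [this, norm_neg, RCLike.norm_conj]

/-- On each ball in `s`, where segments are available, the map differs from the identity by a map
with Lipschitz constant `k < 1`, so the image of the ball is open. -/
lemma isOpen_image_add_conj (hΩ : IsOpen Ω) (hψ : DifferentiableOn ℂ ψ Ω)
    (hk0 : 0 ≤ k) (hk1 : k < 1) (hk : ∀ w ∈ Ω, ‖deriv ψ w‖ < k) {s : Set ℂ} (hs : IsOpen s)
    (hsΩ : s ⊆ Ω) : IsOpen ((fun w => w + (starRingEnd ℂ) (ψ w)) '' s) := by
  have : s = ⋃ p : {p : ℂ × ℝ // Metric.ball p.1 p.2 ⊆ s}, Metric.ball p.1.1 p.1.2 := by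
    refine Subset.antisymm (fun x hx => ?_) (iUnion_subset fun p => p.2)
    obtain ⟨ε, hε, hb⟩ := Metric.isOpen_iff.1 hs x hx
    exact mem_iUnion.2 ⟨⟨(x, ε), hb⟩, Metric.mem_ball_self hε⟩
  rw [this, image_iUnion]
  refine isOpen_iUnion ?_
  rintro ⟨⟨x, ε⟩, hb⟩
  have happ : ApproximatesLinearOn (fun w => w + (starRingEnd ℂ) (ψ w))
      ((ContinuousLinearEquiv.refl ℝ ℂ : ℂ ≃L[ℝ] ℂ) : ℂ →L[ℝ] ℂ) (Metric.ball x ε)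
      ⟨k, hk0⟩ := by
    intro y hy z hz
    have h1 := norm_sub_le_of_segment_subset hΩ hψ hk
      (((convex_ball x ε).segment_subset hy hz).trans (hb.trans hsΩ))
    have e : y + (starRingEnd ℂ) (ψ y) - (z + (starRingEnd ℂ) (ψ z)) - (y - z) =
        (starRingEnd ℂ) (ψ y - ψ z) := by rw [map_sub]; ring
    simp only [ContinuousLinearEquiv.coe_coe, ContinuousLinearEquiv.coe_refl', id]
    rw [e, RCLike.norm_conj]
    exact h1
  have hN : ‖(((ContinuousLinearEquiv.refl ℝ ℂ).symm : ℂ ≃L[ℝ] ℂ) : ℂ →L[ℝ] ℂ)‖₊ = 1 := by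
    ext
    simp
  refine happ.open_image
    (ContinuousLinearEquiv.refl ℝ ℂ).toNonlinearRightInverse Metric.isOpen_ball (Or.inr ?_)
  change _ < (‖_‖₊)⁻¹
  rw [hN, inv_one]
  exact hk1

/-- Under the assumptions of `injOn_add_conj`, the image of `Ω` is invariant under translations in
the direction `-u`. -/
lemma sub_mem_image_add_conj (hΩ : IsOpen Ω) (hψ : DifferentiableOn ℂ ψ Ω)
    (hβ : β ∈ Ioo 0 (Real.pi / 2))
    (hu : ‖u‖ = 1) (hk : ∀ w ∈ Ω, ‖deriv ψ w‖ < Real.sin β)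
    (hcone : ∀ w ∈ Ω, ∀ c ∈ sector β u, w - c ∈ Ω) {p : ℂ}
    (hp : p ∈ (fun w => w + (starRingEnd ℂ) (ψ w)) '' Ω) {r : ℝ} (hr : 0 ≤ r) :
    p - r * u ∈ (fun w => w + (starRingEnd ℂ) (ψ w)) '' Ω := by
  have hs : 0 < Real.sin β := Real.sin_pos_of_pos_of_lt_pi hβ.1 (by linarith [hβ.2, Real.pi_pos])
  have hc : 0 < Real.cos β := Real.cos_pos_of_mem_Ioo ⟨by linarith [hβ.1, Real.pi_pos], hβ.2⟩
  have hs1 : Real.sin β < 1 := by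
    have := Real.sin_sq_add_cos_sq β
    nlinarith [sq_nonneg (Real.cos β)]
  obtain ⟨w, hw, rfl⟩ := hp
  set Φ : ℂ → ℂ := fun w => w + (starRingEnd ℂ) (ψ w) with hΦ
  have est : ∀ {x y : ℂ}, segment ℝ x y ⊆ Ω → ‖Φ x - Φ y - (x - y)‖ ≤ Real.sin β * ‖x - y‖ := by
    intro x y hxy
    have e : Φ x - Φ y - (x - y) = (starRingEnd ℂ) (ψ x - ψ y) := by
      simp only [hΦ, map_sub]; ring
    rw [e, RCLike.norm_conj]
    exact norm_sub_le_of_segment_subset hΩ hψ hk hxy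
  have hΦc : ContinuousOn Φ Ω :=
    continuousOn_id.add (Complex.continuous_conj.comp_continuousOn hψ.continuousOn)
  -- Continuous induction on `r`: the lift `w'` is kept in the convex set `w - sector β u`, where
  -- segments lie in `Ω` and `est` applies.
  set S : Set ℝ := {r | ∃ w', w - w' ∈ sector β u ∧ Φ w' = Φ w - r * u} with hS
  have hVΩ : ∀ {w'}, w - w' ∈ sector β u → w' ∈ Ω := by
    intro w' hw'
    have := hcone w hw _ hw'
    rwa [sub_sub_cancel] at this
  suffices h : r ∈ S by
    obtain ⟨w', h1, h2⟩ := h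
    exact ⟨w', hVΩ h1, h2⟩
  have hsub : Icc 0 r ⊆ S := by
    refine IsClosed.Icc_subset_of_forall_mem_nhdsWithin ?_ ?_ ?_
    · rw [← isSeqClosed_iff_isClosed]
      intro x l hx hl
      choose v hv1 hv2 using fun n => (hx n).1
      -- By `est`, `‖Φ x - Φ y‖ ≥ (1 - sin β) ‖x - y‖` on that set, so lifts of a convergent
      -- sequence are Cauchy.
      have hcau : CauchySeq v := by
        have hxc := hl.cauchySeq
        rw [Metric.cauchySeq_iff'] at hxc ⊢
        intro ε hε
        obtain ⟨N, hN⟩ := hxc (ε * (1 - Real.sin β)) (mul_pos hε (by linarith))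
        refine ⟨N, fun n hn => ?_⟩
        have h1 := est (segment_subset_of_sub_mem_sector hc hcone hw (hv1 n) (hv1 N))
        have h2 : Φ (v n) - Φ (v N) = ((x N - x n : ℝ) : ℂ) * u := by
          rw [hv2, hv2]; push_cast; ring
        have h3 : ‖v n - v N‖ ≤ ‖Φ (v n) - Φ (v N)‖ + ‖Φ (v n) - Φ (v N) - (v n - v N)‖ := by
          have := norm_sub_le (Φ (v n) - Φ (v N)) (Φ (v n) - Φ (v N) - (v n - v N))
          rwa [sub_sub_cancel] at this
        have h4 : ‖Φ (v n) - Φ (v N)‖ = dist (x n) (x N) := by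
          rw [h2, norm_mul, hu, mul_one, Complex.norm_real, dist_comm, dist_eq_norm]
        have h5 := hN n hn
        rw [dist_eq_norm]
        have : ‖v n - v N‖ * (1 - Real.sin β) < ε * (1 - Real.sin β) := by linarith
        exact lt_of_mul_lt_mul_right this (by linarith)
      obtain ⟨v', hv'⟩ := cauchySeq_tendsto_of_complete hcau
      have hmem : w - v' ∈ sector β u :=
        isClosed_sector.mem_of_tendsto (tendsto_const_nhds.sub hv') (Eventually.of_forall hv1)
      refine ⟨⟨v', hmem, ?_⟩, isClosed_Icc.mem_of_tendsto hl (Eventually.of_forall fun n => (hx n).2)⟩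
      have t1 : Tendsto (fun n => Φ (v n)) atTop (𝓝 (Φ v')) :=
        ((hΦc.continuousAt (hΩ.mem_nhds (hVΩ hmem))).tendsto).comp hv'
      have t2 : Tendsto (fun n => Φ (v n)) atTop (𝓝 (Φ w - l * u)) := by
        simp_rw [hv2]
        exact tendsto_const_nhds.sub
          (((Complex.continuous_ofReal.tendsto l).comp hl).mul tendsto_const_nhds)
      exact tendsto_nhds_unique t1 t2
    · exact ⟨w, by simpa using zero_mem_sector, by simp⟩
    · rintro x ⟨⟨v, hv, hvx⟩, -⟩
      obtain ⟨ε, hε, hball⟩ := Metric.isOpen_iff.1 hΩ v (hVΩ hv)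
      have hn : Φ '' Metric.ball v ε ∈ 𝓝 (Φ v) :=
        (isOpen_image_add_conj hΩ hψ hs.le hs1 hk Metric.isOpen_ball hball).mem_nhds
          ⟨v, Metric.mem_ball_self hε, rfl⟩
      have hcont : Tendsto (fun y : ℝ => Φ w - y * u) (𝓝 x) (𝓝 (Φ v)) := by
        rw [hvx]
        exact Continuous.tendsto (by fun_prop) x
      have hev := (hcont.eventually hn).filter_mono (nhdsWithin_le_nhds (s := Ioi x))
      filter_upwards [hev, self_mem_nhdsWithin] with y hy hxy
      obtain ⟨v', hv', hv'y⟩ := hy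
      refine ⟨v', ?_, hv'y⟩
      have h1 := est (((convex_ball v ε).segment_subset (Metric.mem_ball_self hε) hv').trans hball)
      -- Openness of `Φ` gives a lift `v'` near `v`; the image moves by `-(y - x) u`, which forces
      -- the lift to move inside the negative sector.
      have h2 : v - v' ∈ sector β u := by
        refine mem_sector_of_norm_sub_le hu hs hc (ρ := y - x) (sub_pos.2 hxy) ?_
        have e : Φ v - Φ v' - (v - v') = -(v - v' - (y - x : ℝ) * u) := by
          rw [hv'y, hvx]; push_cast; ring
        rwa [e, norm_neg] at h1
      have := smul_mem_sector (convex_sector hc.le hv h2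
        (a := 1 / 2) (b := 1 / 2) (by norm_num) (by norm_num) (by norm_num)) (t := 2) (by norm_num)
      convert this using 1
      simp only [Complex.real_smul]; push_cast; ring
  exact hsub ⟨hr, le_rfl⟩

end Shear

/-! ### Recession cones and the opening angle at infinity. -/

section Recession

/-- The directions in which a plane set is invariant under translations. -/
def recessionDirections (K : Set ℂ) : Set ℂ := {c | ∀ w ∈ K, ∀ t : ℝ, 0 ≤ t → w + t * c ∈ K}

variable {K : Set ℂ}

lemma isClosed_recessionDirections (hK : IsClosed K) : IsClosed (recessionDirections K) := by
  have : recessionDirections K =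
      ⋂ w ∈ K, ⋂ t : ℝ, ⋂ _ : 0 ≤ t, (fun c : ℂ => w + t * c) ⁻¹' K := by
    ext c; simp [recessionDirections]
  rw [this]
  exact isClosed_biInter fun w _ => isClosed_iInter fun t => isClosed_iInter fun _ =>
    hK.preimage (by fun_prop)

lemma add_mem_recessionDirections {a b : ℂ} (ha : a ∈ recessionDirections K)
    (hb : b ∈ recessionDirections K) {s t : ℝ} (hs : 0 ≤ s) (ht : 0 ≤ t) :
    s * a + t * b ∈ recessionDirections K := by
  intro w hw r hr
  have := hb _ (ha w hw (r * s) (by positivity)) (r * t) (by positivity)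
  convert this using 1
  push_cast; ring

/-- The convex combinations `(1 - t / R) w + (t / R) (R c)` lie in `K` for arbitrarily large `R` and
tend to `w + t c`. -/
lemma mem_recessionDirections_of_frequently (hK : IsClosed K) (hconv : Convex ℝ K) {c : ℂ}
    (hc : ∃ᶠ R : ℝ in atTop, (R : ℂ) * c ∈ K) : c ∈ recessionDirections K := by
  intro w hw t ht
  have hlim : Tendsto (fun R : ℝ => w + t * c - ((t / R : ℝ) : ℂ) * w) atTop (𝓝 (w + t * c)) := by
    have h1 : Tendsto (fun R : ℝ => ((t / R : ℝ) : ℂ)) atTop (𝓝 ((0 : ℝ) : ℂ)) :=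
      (Complex.continuous_ofReal.tendsto 0).comp (tendsto_const_nhds.div_atTop tendsto_id)
    simpa using (tendsto_const_nhds (x := w + t * c)).sub (h1.mul_const w)
  refine hK.mem_of_frequently_of_tendsto ?_ hlim
  refine (hc.and_eventually (eventually_ge_atTop (max t 1))).mono ?_
  rintro R ⟨hR, hRt⟩
  have hR1 : (1 : ℝ) ≤ R := (le_max_right _ _).trans hRt
  have hR0 : 0 < R := by linarith
  have htR : t / R ≤ 1 := (div_le_one hR0).2 ((le_max_left _ _).trans hRt)
  have := hconv hw hR (a := 1 - t / R) (b := t / R) (by linarith) (by positivity) (by ring)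
  convert this using 1
  have : (R : ℂ) ≠ 0 := by exact_mod_cast hR0.ne'
  simp only [Complex.real_smul]; push_cast; field_simp; ring

/-- The recession directions of a closed convex proper subset lie in a half-plane. -/
lemma exists_re_nonneg_of_recessionDirections (hK : IsClosed K) (hconv : Convex ℝ K)
    (hne : K.Nonempty) (huniv : K ≠ univ) :
    ∃ φ : ℝ, ∀ τ : ℝ, Complex.exp ((φ + τ : ℝ) * Complex.I) ∈ recessionDirections K →
      0 ≤ Real.cos τ := by
  obtain ⟨x, hx⟩ := (ne_univ_iff_exists_notMem K).1 huniv
  obtain ⟨l, m, hlx, hlK⟩ := geometric_hahn_banach_point_closed hconv hK hx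
  obtain ⟨k, hk⟩ := hne
  have hl : ∀ c ∈ recessionDirections K, 0 ≤ l c := by
    intro c hc
    by_contra hneg
    push Not at hneg
    -- The parameter is chosen so that `l` takes exactly the value `m` at the translated point.
    have h1 := hlK _ (hc k hk ((l k - m) / (-l c))
      (div_nonneg (sub_nonneg.2 (hlK k hk).le) (by linarith)))
    rw [← Complex.real_smul, map_add, map_smul, smul_eq_mul] at h1
    have : (l k - m) / (-l c) * l c = -(l k - m) := by
      have := hneg.ne
      field_simp
    linarith
  set d : ℂ := l 1 + l Complex.I * Complex.I with hd
  have hlc : ∀ c, l c = c.re * d.re + c.im * d.im := by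
    intro c
    conv_lhs => rw [← Complex.re_add_im c]
    have e : (c.re : ℂ) + c.im * Complex.I = c.re • (1 : ℂ) + c.im • Complex.I := by
      simp [Complex.real_smul]
    rw [e, map_add, map_smul, map_smul]
    simp [hd]
  have hd0 : 0 < ‖d‖ := by
    refine norm_pos_iff.2 fun h0 => ?_
    have h1 := hlx.trans (hlK k hk)
    rw [hlc, hlc k, h0] at h1
    simp at h1
  refine ⟨d.arg, fun τ hτ => ?_⟩
  have h1 := hl _ hτ
  rw [hlc, Complex.exp_ofReal_mul_I_re, Complex.exp_ofReal_mul_I_im, ← Complex.norm_mul_cos_arg d,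
    ← Complex.norm_mul_sin_arg d] at h1
  have h2 : Real.cos (d.arg + τ) * (‖d‖ * Real.cos d.arg) +
      Real.sin (d.arg + τ) * (‖d‖ * Real.sin d.arg) = ‖d‖ * Real.cos τ := by
    have := Real.cos_sub (d.arg + τ) d.arg
    rw [add_sub_cancel_left] at this
    rw [this]; ring
  rw [h2] at h1
  exact nonneg_of_mul_nonneg_right h1 hd0

/-- Angles here differ by less than `π`, so an intermediate direction is a nonnegative combination
of the outer two, with sine weights. Hence the measure of this set is controlled by its infimum and
supremum. -/
lemma ordConnected_recessionAngles (φ : ℝ) :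
    OrdConnected {τ : ℝ | τ ∈ Ioo (-(Real.pi / 2)) (Real.pi / 2) ∧
      Complex.exp ((φ + τ : ℝ) * Complex.I) ∈ recessionDirections K} := by
  refine ⟨?_⟩
  rintro x ⟨hx, hxK⟩ y ⟨hy, hyK⟩ τ ⟨h1, h2⟩
  refine ⟨⟨hx.1.trans_le h1, h2.trans_lt hy.2⟩, ?_⟩
  rcases h1.eq_or_lt with rfl | h1
  · exact hxK
  have hD : 0 < Real.sin (y - x) := Real.sin_pos_of_pos_of_lt_pi (by linarith)
    (by linarith [hx.1, hy.2])
  have hs : 0 ≤ Real.sin (y - τ) := Real.sin_nonneg_of_nonneg_of_le_pi (by linarith)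
    (by linarith [hx.1, hy.2])
  have ht : 0 ≤ Real.sin (τ - x) := Real.sin_nonneg_of_nonneg_of_le_pi (by linarith)
    (by linarith [hx.1, hy.2])
  convert add_mem_recessionDirections hxK hyK (div_nonneg hs hD.le) (div_nonneg ht hD.le) using 1
  have hcs : ∀ A : ℝ, Complex.exp (A * Complex.I) = Real.cos A + Real.sin A * Complex.I := by
    intro A; rw [Complex.exp_mul_I]; push_cast; rfl
  rw [hcs, hcs, hcs]
  have hD' : (Real.sin (y - x) : ℂ) ≠ 0 := by exact_mod_cast hD.ne'
  have gen : ∀ F : ℝ → ℝ, (∃ p q, ∀ A, F A = p * Real.cos A + q * Real.sin A) →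
      Real.sin (y - x) * F τ = Real.sin (y - τ) * F x + Real.sin (τ - x) * F y := by
    rintro F ⟨p, q, hF⟩
    rw [hF, hF, hF, Real.sin_sub, Real.sin_sub, Real.sin_sub]
    ring
  have e1 := gen (fun A => Real.cos (φ + A)) ⟨Real.cos φ, -Real.sin φ, fun A => by
    rw [Real.cos_add]; ring⟩
  have e2 := gen (fun A => Real.sin (φ + A)) ⟨Real.sin φ, Real.cos φ, fun A => by
    rw [Real.sin_add]⟩
  have e1' : (Real.sin (y - x) : ℂ) * Real.cos (φ + τ) = Real.sin (y - τ) * Real.cos (φ + x) +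
    Real.sin (τ - x) * Real.cos (φ + y) := by exact_mod_cast e1
  have e2' : (Real.sin (y - x) : ℂ) * Real.sin (φ + τ) = Real.sin (y - τ) * Real.sin (φ + x) +
    Real.sin (τ - x) * Real.sin (φ + y) := by exact_mod_cast e2
  rw [Complex.ofReal_div, Complex.ofReal_div]
  field_simp
  linear_combination e1' + Complex.I * e2'

/-- Any interval of length `2π` is a fundamental domain for the angles. Recentring at `φ` avoids the
cut at `±π`, and the half-plane condition leaves only `[-π/2, π/2]`, whose endpoints are null. -/
lemma volume_recessionAngles_le (hK : IsClosed K) {φ : ℝ}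
    (hφ : ∀ τ : ℝ, Complex.exp ((φ + τ : ℝ) * Complex.I) ∈ recessionDirections K →
      0 ≤ Real.cos τ) :
    volume {θ : ℝ | θ ∈ Ioc (-Real.pi) Real.pi ∧
        Complex.exp (θ * Complex.I) ∈ recessionDirections K} ≤
      volume {τ : ℝ | τ ∈ Ioo (-(Real.pi / 2)) (Real.pi / 2) ∧
        Complex.exp ((φ + τ : ℝ) * Complex.I) ∈ recessionDirections K} := by
  set A : Set ℝ := {θ : ℝ | Complex.exp (θ * Complex.I) ∈ recessionDirections K} with hA
  have hmeas : MeasurableSet A :=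
    ((isClosed_recessionDirections hK).preimage (by fun_prop)).measurableSet
  have hinv : ∀ g : AddSubgroup.zmultiples (2 * Real.pi), (fun x => g +ᵥ x) ⁻¹' A = A := by
    rintro ⟨_, n, rfl⟩
    ext x
    simp only [hA, mem_preimage, mem_ofPred_eq, AddSubgroup.vadd_def, vadd_eq_add]
    have : Complex.exp (((n • (2 * Real.pi) + x : ℝ) : ℂ) * Complex.I) =
        Complex.exp (x * Complex.I) := by
      rw [Complex.exp_eq_exp_iff_exists_int]
      exact ⟨n, by push_cast [zsmul_eq_mul]; ring⟩
    rw [this]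
  have h1 := isAddFundamentalDomain_Ioc Real.two_pi_pos (-Real.pi)
  have h2 := isAddFundamentalDomain_Ioc Real.two_pi_pos (φ - Real.pi)
  have h3 := h1.measure_set_eq h2 hmeas hinv
  have e1 : {θ : ℝ | θ ∈ Ioc (-Real.pi) Real.pi ∧
      Complex.exp (θ * Complex.I) ∈ recessionDirections K} =
      A ∩ Ioc (-Real.pi) (-Real.pi + 2 * Real.pi) := by
    rw [show -Real.pi + 2 * Real.pi = Real.pi by ring, inter_comm]; rfl
  rw [e1, h3, ← measure_preimage_add volume φ]
  have hsub : (fun τ => φ + τ) ⁻¹' (A ∩ Ioc (φ - Real.pi) (φ - Real.pi + 2 * Real.pi)) ⊆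
      {τ : ℝ | τ ∈ Ioo (-(Real.pi / 2)) (Real.pi / 2) ∧
        Complex.exp ((φ + τ : ℝ) * Complex.I) ∈ recessionDirections K} ∪
        {-(Real.pi / 2), Real.pi / 2} := by
    rintro τ ⟨hτ, hτ1, hτ2⟩
    have hcos := hφ τ hτ
    have b1 : -(Real.pi / 2) ≤ τ := by
      by_contra h
      push Not at h
      have := Real.cos_neg_of_pi_div_two_lt_of_lt (x := -τ) (by linarith) (by linarith)
      rw [Real.cos_neg] at this
      linarith
    have b2 : τ ≤ Real.pi / 2 := by
      by_contra h
      push Not at h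
      have := Real.cos_neg_of_pi_div_two_lt_of_lt (x := τ) (by linarith)
        (by linarith [Real.pi_pos])
      linarith
    rcases b1.eq_or_lt with h | h
    · exact Or.inr (by simp [← h])
    rcases b2.eq_or_lt with h' | h'
    · exact Or.inr (by simp [h'])
    exact Or.inl ⟨⟨h, h'⟩, hτ⟩
  refine (measure_mono hsub).trans ((measure_union_le _ _).trans ?_)
  rw [(Set.toFinite ({-(Real.pi / 2), Real.pi / 2} : Set ℝ)).measure_zero volume, add_zero]

/-- Take the bisector of the angular interval as axis: both edges of the sector are then recession
directions, and they generate it. -/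
lemma exists_sector_of_sub_le {m M β φ : ℝ} (hβ : β ∈ Ioo 0 (Real.pi / 2)) (hmM : 2 * β ≤ M - m)
    (h : ∀ τ ∈ Icc m M, Complex.exp ((φ + τ : ℝ) * Complex.I) ∈ recessionDirections K) :
    ∃ u : ℂ, ‖u‖ = 1 ∧ sector β u ⊆ recessionDirections K := by
  have hs : 0 < Real.sin β := Real.sin_pos_of_pos_of_lt_pi hβ.1 (by linarith [hβ.2, Real.pi_pos])
  have hc : 0 < Real.cos β := Real.cos_pos_of_mem_Ioo ⟨by linarith [hβ.1, Real.pi_pos], hβ.2⟩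
  refine ⟨Complex.exp ((φ + (m + M) / 2 : ℝ) * Complex.I), Complex.norm_exp_ofReal_mul_I _, ?_⟩
  intro c hcs
  rw [eq_extreme_add_extreme hs.ne' hc.ne' (Complex.exp_ne_zero ((φ + (m + M) / 2 : ℝ) * Complex.I)) c]
  have habs : |(c / Complex.exp ((φ + (m + M) / 2 : ℝ) * Complex.I)).im| / Real.sin β ≤
      (c / Complex.exp ((φ + (m + M) / 2 : ℝ) * Complex.I)).re / Real.cos β :=
    (div_le_div_iff₀ hs hc).2 hcs
  nth_rewrite 1 [← abs_of_pos hs] at habs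
  rw [← abs_div] at habs
  obtain ⟨h1, h2⟩ := abs_le.1 habs
  refine add_mem_recessionDirections ?_ ?_ (by linarith) (by linarith)
  · convert h ((m + M) / 2 + β) ⟨by linarith [hβ.1], by linarith⟩ using 1
    rw [← Complex.exp_add]; congr 1; push_cast; ring
  · convert h ((m + M) / 2 - β) ⟨by linarith, by linarith [hβ.1]⟩ using 1
    rw [← Complex.exp_add]; congr 1; push_cast; ring

/-- A closed convex set whose complement has opening angle at most `πα` at infinity is invariant
under translations by a sector of half-angle `(2 - α)π / 2`. -/
lemma exists_sector_subset_recessionDirections (hK : IsClosed K) (hconv : Convex ℝ K)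
    (huniv : K ≠ univ) {α : ℝ} (hα : α ∈ Ioo (1 : ℝ) 2)
    (hang : openingAngleAtInfinity Kᶜ ≤ ENNReal.ofReal (Real.pi * α)) :
    ∃ u : ℂ, ‖u‖ = 1 ∧ sector ((2 - α) / 2 * Real.pi) u ⊆ recessionDirections K := by
  have hpi := Real.pi_pos
  have hβ : (2 - α) / 2 * Real.pi ∈ Ioo 0 (Real.pi / 2) :=
    ⟨by nlinarith [hα.2], by nlinarith [hα.1]⟩
  rcases K.eq_empty_or_nonempty with rfl | hne
  · exact ⟨1, by simp, fun c _ => by simp [recessionDirections]⟩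
  obtain ⟨φ, hφ⟩ := exists_re_nonneg_of_recessionDirections hK hconv hne huniv
  set B : Set ℝ := {τ : ℝ | τ ∈ Ioo (-(Real.pi / 2)) (Real.pi / 2) ∧
    Complex.exp ((φ + τ : ℝ) * Complex.I) ∈ recessionDirections K} with hB
  have hvol : ENNReal.ofReal (2 * ((2 - α) / 2 * Real.pi)) ≤ volume B := by
    refine le_trans ?_ (volume_recessionAngles_le hK hφ)
    -- The first set has measure at most `πα`, so at least `2π - πα` is left for the second.
    have hcov : Ioc (-Real.pi) Real.pi ⊆
        {θ : ℝ | θ ∈ Ioc (-Real.pi) Real.pi ∧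
          ∀ᶠ R : ℝ in atTop, (R : ℂ) * Complex.exp ((θ : ℂ) * Complex.I) ∈ Kᶜ} ∪
        {θ : ℝ | θ ∈ Ioc (-Real.pi) Real.pi ∧
          Complex.exp (θ * Complex.I) ∈ recessionDirections K} := by
      intro θ hθ
      by_cases hev : ∀ᶠ R : ℝ in atTop, (R : ℂ) * Complex.exp ((θ : ℂ) * Complex.I) ∈ Kᶜ
      · exact Or.inl ⟨hθ, hev⟩
      · refine Or.inr ⟨hθ, mem_recessionDirections_of_frequently hK hconv ?_⟩
        rw [not_eventually] at hev
        exact hev.mono fun R hR => not_not.1 hR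
    have h1 := (measure_mono (μ := volume) hcov).trans (measure_union_le _ _)
    rw [Real.volume_Ioc] at h1
    have h2 := h1.trans (add_le_add_left hang _)
    have e : 2 * ((2 - α) / 2 * Real.pi) = (Real.pi - -Real.pi) - Real.pi * α := by ring
    rw [e, ENNReal.ofReal_sub _ (by nlinarith [hα.1]), tsub_le_iff_left]
    exact h2
  have hBne : B.Nonempty := by
    refine nonempty_of_measure_ne_zero (μ := volume) fun h0 => ?_
    rw [h0, nonpos_iff_eq_zero, ENNReal.ofReal_eq_zero] at hvol
    linarith [hβ.1]
  have hBa : BddAbove B := ⟨Real.pi / 2, fun x hx => hx.1.2.le⟩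
  have hBb : BddBelow B := ⟨-(Real.pi / 2), fun x hx => hx.1.1.le⟩
  have hle : ENNReal.ofReal (2 * ((2 - α) / 2 * Real.pi)) ≤ ENNReal.ofReal (sSup B - sInf B) := by
    rw [← Real.volume_Icc]
    exact hvol.trans (measure_mono fun x hx => ⟨csInf_le hBb hx, le_csSup hBa hx⟩)
  have hmM : 2 * ((2 - α) / 2 * Real.pi) ≤ sSup B - sInf B := by
    by_contra h
    push Not at h
    exact absurd hle (not_le.2 ((ENNReal.ofReal_lt_ofReal_iff (by linarith [hβ.1])).2 h))
  refine exists_sector_of_sub_le (φ := φ) hβ hmM fun τ hτ => ?_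
  -- The extreme angles need not belong to `B`; closedness of the recession cone supplies them.
  have hcl : IsClosed {τ : ℝ | Complex.exp ((φ + τ : ℝ) * Complex.I) ∈ recessionDirections K} :=
    (isClosed_recessionDirections hK).preimage (by fun_prop)
  have hlt : sInf B < sSup B := by linarith [hβ.1]
  have hIoo : Ioo (sInf B) (sSup B) ⊆
      {τ : ℝ | Complex.exp ((φ + τ : ℝ) * Complex.I) ∈ recessionDirections K} := by
    intro x hx
    obtain ⟨y, hy, hyx⟩ := exists_lt_of_csInf_lt hBne hx.1
    obtain ⟨z, hz, hxz⟩ := exists_lt_of_lt_csSup hBne hx.2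
    exact ((ordConnected_recessionAngles φ).out hy hz ⟨hyx.le, hxz.le⟩).2
  have := hcl.closure_subset_iff.2 hIoo
  rw [closure_Ioo hlt.ne] at this
  exact this hτ

end Recession

/-! ### Complements as unions of parallel half-lines. -/

section CloseToConvex

/-- An open set invariant under translations in the direction `-u` is close-to-convex: its
complement is a union of parallel half-lines. -/
lemma isCloseToConvexDomain_of_sub_mem {V : Set ℂ} (hV : IsOpen V) {u : ℂ} (hu : ‖u‖ = 1)
    (h : ∀ p ∈ V, ∀ r : ℝ, 0 ≤ r → p - r * u ∈ V) : IsCloseToConvexDomain V := by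
  have hu0 : u ≠ 0 := norm_ne_zero_iff.1 (by rw [hu]; exact one_ne_zero)
  have hup : ∀ p ∉ V, ∀ r : ℝ, 0 ≤ r → p + r * u ∉ V := by
    intro p hp r hr hmem
    exact hp (by simpa using h _ hmem r hr)
  -- half-lines issuing from boundary points, and the two halves of each line avoiding `V`
  set L₁ : Set (ℂ × ℂ) := {p | p.2 = u ∧ p.1 ∉ V ∧ ∀ r : ℝ, 0 < r → p.1 - r * u ∈ V} with hL₁
  set L₂ : Set (ℂ × ℂ) := {p | (p.2 = u ∨ p.2 = -u) ∧ (p.1 / u).re = 0 ∧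
    ∀ r : ℝ, p.1 + r * u ∉ V} with hL₂
  have hdir : ∀ p ∈ L₁ ∪ L₂, p.2 = u ∨ p.2 = -u := by
    rintro p (hp | hp)
    · exact Or.inl hp.1
    · exact hp.1
  have hray : ∀ p ∈ L₁ ∪ L₂, ∀ t : ℝ, ∃ t' : ℝ, p.1 + t * p.2 = p.1 + t' * u := by
    intro p hp t
    rcases hdir p hp with e | e
    · exact ⟨t, by rw [e]⟩
    · exact ⟨-t, by rw [e]; push_cast; ring⟩
  have h12 : ∀ p ∈ L₁, ∀ q ∈ L₂, ∀ s : ℝ, p.1 ≠ q.1 + s * u := by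
    intro p hp q hq s e
    refine hq.2.2 (s - 1) ?_
    have := hp.2.2 1 one_pos
    rw [e] at this
    convert this using 1
    push_cast; ring
  have h11 : ∀ p ∈ L₁, ∀ q ∈ L₁, ∀ s : ℝ, p.1 = q.1 + s * u → s ≤ 0 := by
    intro p hp q hq s e
    by_contra hs
    push Not at hs
    have := hp.2.2 s hs
    rw [e, add_sub_cancel_right] at this
    exact hq.2.1 this
  refine ⟨L₁ ∪ L₂, fun p hp => ?_, ?_, ?_⟩
  · rcases hdir p hp with e | e <;> simp [e, hu]
  · intro p hp q hq hpq
    refine disjoint_left.2 ?_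
    rintro w ⟨t, ht, hw⟩ ⟨t', ht', hw'⟩
    obtain ⟨a, ha⟩ := hray p hp t
    obtain ⟨b, hb⟩ := hray q hq t'
    have hpq1 : p.1 = q.1 + (b - a : ℝ) * u := by
      push_cast
      linear_combination hb - ha + hw' - hw
    have hqp1 : q.1 = p.1 + (a - b : ℝ) * u := by
      push_cast
      linear_combination -hb + ha - hw' + hw
    rcases hp with hp1 | hp2 <;> rcases hq with hq1 | hq2
    · have e1 := h11 p hp1 q hq1 _ hpq1
      have e2 := h11 q hq1 p hp1 _ hqp1
      have e3 : b - a = 0 := by linarith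
      refine hpq (Prod.ext ?_ (hp1.1.trans hq1.1.symm))
      rw [hpq1, e3]; simp
    · exact h12 p hp1 q hq2 _ hpq1
    · exact h12 q hq1 p hp2 _ hqp1
    -- The normalization `(p.1 / u).re = 0` gives both half-lines on a common line the same origin,
    -- so distinct ones are opposite.
    · have e1 := hp2.2.1
      rw [hpq1, add_div, mul_div_cancel_right₀ _ hu0, Complex.add_re, hq2.2.1, zero_add,
        Complex.ofReal_re] at e1
      rw [e1, Complex.ofReal_zero, zero_mul, add_zero] at hpq1
      have e2 : p.2 ≠ q.2 := fun e => hpq (Prod.ext hpq1 e)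
      have e3 : p.2 = -q.2 := by
        rcases hp2.1 with h1 | h1 <;> rcases hq2.1 with h2 | h2
        · exact absurd (h1.trans h2.symm) e2
        · rw [h1, h2, neg_neg]
        · rw [h1, h2]
        · exact absurd (h1.trans h2.symm) e2
      have e4 : ((t + t' : ℝ) : ℂ) * q.2 = 0 := by
        rw [hw, hpq1, e3] at hw'
        push_cast
        linear_combination -hw'
      have e5 : q.2 ≠ 0 := by rcases hq2.1 with h2 | h2 <;> simp [h2, hu0]
      have e6 : t + t' = 0 := by
        exact_mod_cast (mul_eq_zero.1 e4).resolve_right e5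
      linarith
  · refine Subset.antisymm (fun w hw => ?_) ?_
    · by_cases hline : ∀ s : ℝ, w - s * u ∉ V
      · have hre : w = w - ((w / u).re : ℝ) * u + ((w / u).re : ℝ) * u := by ring
        have hmem : ∀ d : ℂ, d = u ∨ d = -u → (w - ((w / u).re : ℝ) * u, d) ∈ L₂ := by
          intro d hd
          refine ⟨hd, ?_, fun r => ?_⟩
          · simp only [sub_div, mul_div_cancel_right₀ _ hu0, Complex.sub_re, Complex.ofReal_re,
              sub_self]
          · have := hline ((w / u).re - r)
            convert this using 2
            push_cast; ring
        rcases le_total 0 (w / u).re with h0 | h0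
        · exact mem_biUnion (Or.inr (hmem u (Or.inl rfl))) ⟨_, h0, hre⟩
        · refine mem_biUnion (Or.inr (hmem (-u) (Or.inr rfl)))
            ⟨-(w / u).re, neg_nonneg.2 h0, ?_⟩
          push_cast; ring
      · push Not at hline
        obtain ⟨s, hs⟩ := hline
        -- The half-line through `w` starts at the last point outside `V` met when going back along
        -- `-u`, at parameter `sSup T`.
        set T : Set ℝ := {t | w - t * u ∉ V} with hT
        have hTc : IsClosed T := hV.isClosed_compl.preimage
          (f := fun t : ℝ => w - t * u) (by fun_prop)
        have hT0 : (0 : ℝ) ∈ T := by simpa [hT] using hw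
        have hTb : BddAbove T := by
          refine ⟨s, fun t ht => ?_⟩
          by_contra hst
          push Not at hst
          refine ht ?_
          have := h _ hs (t - s) (by linarith)
          convert this using 1
          push_cast; ring
        have hmem : sSup T ∈ T := hTc.csSup_mem ⟨0, hT0⟩ hTb
        refine mem_biUnion (x := (w - sSup T * u, u)) (Or.inl ⟨rfl, hmem, fun r hr => ?_⟩)
          ⟨sSup T, le_csSup hTb hT0, by ring⟩
        by_contra hn
        have : sSup T + r ∈ T := by
          intro hv
          refine hn ?_
          convert hv using 1
          push_cast; ring
        linarith [le_csSup hTb this]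
    · refine iUnion₂_subset ?_
      rintro p (hp | hp) _ ⟨t, ht, rfl⟩
      · rw [hp.1]
        exact hup _ hp.2.1 t ht
      · obtain ⟨t', e⟩ := hray p (Or.inr hp) t
        rw [e]
        exact hp.2.2 t'

end CloseToConvex

/-! ### Reduction to the shear of `h(𝔻)`. -/

theorem mainTheorem3 (α : ℝ) (hα : α ∈ Set.Ioo (1 : ℝ) 2) (f h g ω : ℂ → ℂ)
    (hf : MemCOH α f h g ω)
    (hω : ∀ z ∈ unitDisk, ‖ω z‖ < Real.sin ((2 - α) / 2 * Real.pi)) :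
    IsCloseToConvex f := by
  have hpi := Real.pi_pos
  have hβ : (2 - α) / 2 * Real.pi ∈ Ioo 0 (Real.pi / 2) :=
    ⟨by nlinarith [hα.2], by nlinarith [hα.1]⟩
  have hU : IsOpen unitDisk := Metric.isOpen_ball
  have hc : IsPreconnected unitDisk := (convex_ball (0 : ℂ) 1).isPreconnected
  have hd := hf.concave.analytic
  have hi := hf.concave.univalent
  set Ω := h '' unitDisk with hΩdef
  set φ := Function.invFunOn h unitDisk with hφdef
  have hφ : ∀ z ∈ unitDisk, φ (h z) = z := fun z hz => hi.leftInvOn_invFunOn hz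
  have hΩ : IsOpen Ω := isOpen_image_of_injOn hU hc hd hi subset_rfl hU
  -- The chain rule gives `ψ' = g' / h' = ω` at corresponding points.
  have hψ' : ∀ z ∈ unitDisk, HasDerivAt (g ∘ φ) (ω z) (h z) := by
    intro z hz
    have h0 := deriv_ne_zero_of_injOn hU hc hd hi hz
    have h1 : HasDerivAt g (deriv g z) (φ (h z)) := by
      rw [hφ z hz]; exact (hf.analytic.differentiableAt (hU.mem_nhds hz)).hasDerivAt
    have h2 := h1.comp (h z) (hasDerivAt_invFunOn hU hc hd hi hz h0)
    rwa [hf.dilatation z hz, mul_assoc, mul_inv_cancel₀ h0, mul_one] at h2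
  have hψ : DifferentiableOn ℂ (g ∘ φ) Ω := by
    rintro _ ⟨z, hz, rfl⟩
    exact (hψ' z hz).differentiableAt.differentiableWithinAt
  have hk : ∀ w ∈ Ω, ‖deriv (g ∘ φ) w‖ < Real.sin ((2 - α) / 2 * Real.pi) := by
    rintro _ ⟨z, hz, rfl⟩
    rw [(hψ' z hz).deriv]
    exact hω z hz
  have hz0 : (0 : ℂ) ∈ unitDisk := Metric.mem_ball_self one_pos
  obtain ⟨u, hu, hsec⟩ := exists_sector_subset_recessionDirections hΩ.isClosed_compl
    hf.concave.convex_compl (fun huniv => (huniv ▸ mem_univ (h 0) : h 0 ∈ Ωᶜ) ⟨0, hz0, rfl⟩) hα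
    (by rw [compl_compl]; exact hf.concave.openingAngle_le)
  have hcone : ∀ w ∈ Ω, ∀ c ∈ sector ((2 - α) / 2 * Real.pi) u, w - c ∈ Ω := by
    intro w hw c hcs
    by_contra hn
    have := hsec hcs _ hn 1 zero_le_one
    rw [Complex.ofReal_one, one_mul, sub_add_cancel] at this
    exact this hw
  have hfΦ : ∀ z ∈ unitDisk, f z = h z + (starRingEnd ℂ) ((g ∘ φ) (h z)) := by
    intro z hz
    rw [hf.decomposition z hz, Function.comp_apply, hφ z hz]
  have himg : f '' unitDisk = (fun w => w + (starRingEnd ℂ) ((g ∘ φ) w)) '' Ω := by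
    rw [hΩdef, image_image]
    exact image_congr hfΦ
  refine ⟨fun x hx y hy hxy => ?_, ?_⟩
  · rw [hfΦ x hx, hfΦ y hy] at hxy
    exact hi hx hy (injOn_add_conj hΩ hψ hβ hu hk hcone ⟨x, hx, rfl⟩ ⟨y, hy, rfl⟩ hxy)
  · have hs0 : 0 ≤ Real.sin ((2 - α) / 2 * Real.pi) :=
      Real.sin_nonneg_of_nonneg_of_le_pi hβ.1.le (by linarith [hβ.2])
    have hs1 : Real.sin ((2 - α) / 2 * Real.pi) < 1 := by
      rw [← Real.sin_pi_div_two]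
      exact Real.sin_lt_sin_of_lt_of_le_pi_div_two (by linarith [hβ.1]) le_rfl hβ.2
    rw [himg]
    exact isCloseToConvexDomain_of_sub_mem (isOpen_image_add_conj hΩ hψ hs0 hs1 hk hΩ subset_rfl)
      hu fun p hp r hr => sub_mem_image_add_conj hΩ hψ hβ hu hk hcone hp hr
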